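/- For integers $n>m\geq 0$, let $Z_{n,m}$ denote the maximal number of distinct zeros in $\mathbb{C}$ of a harmonic polynomial $h(z)=p_n(z)+\overline{q_m(z)}$, where $p_n$ and $q_m$ range over the complex polynomials of degree exactly $n$ and exactly $m$, respectively (this maximum exists and is finite). Then, for every fixed integer $a\geq 1$, $$\limsup_{n\to\infty}\frac{Z_{n,n-a}}{n^2}=1.$$ More generally, let $0\leq\alpha\leq 1$ and let $m=m(n)$ be nonnegative integers with $m(n)<n$ for all sufficiently large $n$ and $m(n)=\alpha n+o(n)$ as $n\to\infty$. Then $$\limsup_{n\to\infty}\frac{Z_{n,m(n)}}{n^2}\geq\alpha^2.$$ -/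

import Mathlib

open Filter Asymptotics
open scoped ENNReal Polynomial ComplexConjugate

/-- The set of (distinct) zeros in `ℂ` of the harmonic polynomial `h(z) = p(z) + conj (q(z))`. -/
def harmonicZeros (p q : ℂ[X]) : Set ℂ :=
  {z : ℂ | p.eval z + conj (q.eval z) = 0}

/-- All numbers of zeros that occur for harmonic polynomials `p + conj q` with `p` of degree
exactly `n` and `q` of degree exactly `m` (so that `p` and `q` are not zero). An infinite zero
set is recorded as `⊤`. -/
def harmonicZeroCounts (n m : ℕ) : Set ℕ∞ :=
  {k | ∃ p q : ℂ[X], p.degree = n ∧ q.degree = m ∧ (harmonicZeros p q).encard = k}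

/-- `Z n m`, the maximal number of zeros of `p + conj q`, `deg p = n`, `deg q = m`, as a supremum
in `ℕ ∪ {∞}`; the main theorem asserts that for `m < n` it is finite and a maximum. -/
noncomputable def maxHarmonicZeros (n m : ℕ) : ℕ∞ :=
  sSup (harmonicZeroCounts n m)

/-- The ratio `Z n m / n ^ 2`, as an extended nonnegative real. -/
noncomputable def maxHarmonicZerosRatio (n m : ℕ) : ℝ≥0∞ :=
  (maxHarmonicZeros n m : ℝ≥0∞) / (n : ℝ≥0∞) ^ 2

/-!
The counts are pinned between `m ^ 2 ≤ Z n m` and `Z n m ≤ n ^ 2`, for all `m < n`.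

Upper bound (`encard_harmonicZeros_le`). Let `S` be a finite set of zeros. On `S` the relation
`p(z) = -conj (q(z))`, and its conjugate, rewrite `z ^ n` and `conj z ^ n` as combinations of
monomials `z ^ i * conj z ^ j` of smaller total degree, because `m < n`. Hence the `n ^ 2` monomials
with `i, j < n` span all polynomial functions on `S`, which by Lagrange interpolation are all
functions on `S`; so `S` has at most `n ^ 2` elements. This is Bézout's bound in the only case
needed.

Lower bound (`mul_succ_le_maxHarmonicZeros`). Put `N = m + 1`, `p = (X ^ N + (X - 1) ^ N) / 2` and
`q = (X ^ N - (X - 1) ^ N) / 2`. Then `p + conj q` has real part `Re (z ^ N)` and imaginary part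
`Im ((z - 1) ^ N)`, so its zeros are the intersections of `N` lines through `0` with `N` lines
through `1`. Exactly one of these lines is the real axis, and without it there are `N * m`
intersection points, at all of which `|p'| ≠ |q'|`, so that the real Jacobian does not vanish.
Such zeros persist when `ε X ^ n` is added to `p` for a small `ε > 0`
(`eventually_exists_zero_add_smul`), which makes the degrees exactly `n` and `m`.
-/

/-! ### The upper bound -/

/-- The function `z ↦ z ^ i * conj z ^ j` on a finite set of complex numbers. -/
noncomputable def conjMonomial (S : Finset ℂ) (i j : ℕ) : S → ℂ :=
  fun z => (z : ℂ) ^ i * conj (z : ℂ) ^ j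

/-- Degree reduction: where `p + conj q` vanishes, every monomial in `z` and `conj z` is a
combination of those of degree less than `deg p` in each of the two variables. -/
theorem conjMonomial_mem_span {S : Finset ℂ} {p q : ℂ[X]} (hS : (S : Set ℂ) ⊆ harmonicZeros p q)
    (hpq : q.natDegree < p.natDegree) (i j : ℕ) :
    conjMonomial S i j ∈ Submodule.span ℂ (Set.range fun x : Fin p.natDegree × Fin p.natDegree =>
      conjMonomial S x.1 x.2) := by
  set n := p.natDegree with hn
  set V := Submodule.span ℂ (Set.range fun x : Fin n × Fin n => conjMonomial S x.1 x.2) with hV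
  have hlead : p.leadingCoeff ≠ 0 := by
    rw [Ne, Polynomial.leadingCoeff_eq_zero]
    rintro rfl
    simp at hn
    omega
  have hlead' : conj p.leadingCoeff ≠ 0 := by simpa using hlead
  -- The relation satisfied on `S`, with the leading term of `p` separated.
  have key : ∀ z ∈ S, p.leadingCoeff * z ^ n = -(∑ k ∈ Finset.range n, p.coeff k * z ^ k)
      - ∑ k ∈ Finset.range n, conj (q.coeff k) * conj z ^ k := by
    intro z hz
    have h : p.eval z + conj (q.eval z) = 0 := hS hz
    rw [Polynomial.eval_eq_sum_range, Polynomial.eval_eq_sum_range' hpq, Finset.sum_range_succ,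
      map_sum] at h
    simp only [map_mul, map_pow] at h
    rw [Polynomial.leadingCoeff]
    linear_combination h
  have key' : ∀ z ∈ S, conj p.leadingCoeff * conj z ^ n
      = -(∑ k ∈ Finset.range n, conj (p.coeff k) * conj z ^ k)
      - ∑ k ∈ Finset.range n, q.coeff k * z ^ k := by
    intro z hz
    have h := congrArg conj (key z hz)
    simpa only [map_mul, map_pow, map_sub, map_neg, map_sum, Complex.conj_conj] using h
  obtain ⟨d, hd⟩ : ∃ d, i + j = d := ⟨_, rfl⟩
  induction d using Nat.strong_induction_on generalizing i j with
  | _ d ih =>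
    subst hd
    by_cases hi : n ≤ i
    · obtain ⟨i, rfl⟩ := Nat.exists_eq_add_of_le hi
      have : conjMonomial S (n + i) j = p.leadingCoeff⁻¹ •
          (-(∑ k ∈ Finset.range n, p.coeff k • conjMonomial S (k + i) j)
          - ∑ k ∈ Finset.range n, conj (q.coeff k) • conjMonomial S i (k + j)) := by
        ext z
        have h := key z z.2
        simp only [conjMonomial, Pi.smul_apply, Pi.sub_apply, Pi.neg_apply, Finset.sum_apply,
          smul_eq_mul]
        rw [eq_inv_mul_iff_mul_eq₀ hlead]
        calc p.leadingCoeff * ((z : ℂ) ^ (n + i) * conj (z : ℂ) ^ j)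
            = p.leadingCoeff * (z : ℂ) ^ n * ((z : ℂ) ^ i * conj (z : ℂ) ^ j) := by ring
          _ = _ := by
            rw [h, sub_mul, neg_mul, Finset.sum_mul, Finset.sum_mul]
            congr 1
            · congr 1
              exact Finset.sum_congr rfl fun k _ => by ring
            · exact Finset.sum_congr rfl fun k _ => by ring
      rw [this]
      refine V.smul_mem _ (V.sub_mem (V.neg_mem (V.sum_mem fun k hk => V.smul_mem _ ?_))
        (V.sum_mem fun k hk => V.smul_mem _ ?_))
      · have := Finset.mem_range.1 hk
        exact ih _ (by omega) _ _ rfl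
      · have := Finset.mem_range.1 hk
        exact ih _ (by omega) _ _ rfl
    by_cases hj : n ≤ j
    · obtain ⟨j, rfl⟩ := Nat.exists_eq_add_of_le hj
      have : conjMonomial S i (n + j) = (conj p.leadingCoeff)⁻¹ •
          (-(∑ k ∈ Finset.range n, conj (p.coeff k) • conjMonomial S i (k + j))
          - ∑ k ∈ Finset.range n, q.coeff k • conjMonomial S (k + i) j) := by
        ext z
        have h := key' z z.2
        simp only [conjMonomial, Pi.smul_apply, Pi.sub_apply, Pi.neg_apply, Finset.sum_apply,
          smul_eq_mul]
        rw [eq_inv_mul_iff_mul_eq₀ hlead']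
        calc conj p.leadingCoeff * ((z : ℂ) ^ i * conj (z : ℂ) ^ (n + j))
            = conj p.leadingCoeff * conj (z : ℂ) ^ n * ((z : ℂ) ^ i * conj (z : ℂ) ^ j) := by ring
          _ = _ := by
            rw [h, sub_mul, neg_mul, Finset.sum_mul, Finset.sum_mul]
            congr 1
            · congr 1
              exact Finset.sum_congr rfl fun k _ => by ring
            · exact Finset.sum_congr rfl fun k _ => by ring
      rw [this]
      refine V.smul_mem _ (V.sub_mem (V.neg_mem (V.sum_mem fun k hk => V.smul_mem _ ?_))
        (V.sum_mem fun k hk => V.smul_mem _ ?_))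
      · have := Finset.mem_range.1 hk
        exact ih _ (by omega) _ _ rfl
      · have := Finset.mem_range.1 hk
        exact ih _ (by omega) _ _ rfl
    · exact Submodule.subset_span ⟨(⟨i, by omega⟩, ⟨j, by omega⟩), rfl⟩

theorem card_le_of_subset_harmonicZeros {S : Finset ℂ} {p q : ℂ[X]}
    (hS : (S : Set ℂ) ⊆ harmonicZeros p q) (hpq : q.natDegree < p.natDegree) :
    S.card ≤ p.natDegree ^ 2 := by
  have htop : Submodule.span ℂ (Set.range fun x : Fin p.natDegree × Fin p.natDegree =>
      conjMonomial S x.1 x.2) = ⊤ := by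
    refine eq_top_iff.2 fun f _ => ?_
    -- Lagrange interpolation: `f` is a polynomial in `z` alone.
    set P : ℂ[X] := Lagrange.interpolate Finset.univ (fun z : S => (z : ℂ)) f with hP
    have : f = ∑ k ∈ Finset.range (P.natDegree + 1), P.coeff k • conjMonomial S k 0 := by
      ext z
      have h := Lagrange.eval_interpolate_at_node (s := Finset.univ) (v := fun z : S => (z : ℂ)) f
        Subtype.val_injective.injOn (Finset.mem_univ z)
      rw [← h, ← hP, Polynomial.eval_eq_sum_range]
      simp [conjMonomial]
    rw [this]
    exact Submodule.sum_mem _ fun k _ => Submodule.smul_mem _ _ (conjMonomial_mem_span hS hpq k 0)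
  have h := finrank_range_le_card (R := ℂ) (fun x : Fin p.natDegree × Fin p.natDegree =>
      conjMonomial S x.1 x.2)
  rw [Set.finrank, htop, finrank_top, Module.finrank_fintype_fun_eq_card] at h
  simpa [sq] using h

theorem encard_harmonicZeros_le {p q : ℂ[X]} (hpq : q.natDegree < p.natDegree) :
    (harmonicZeros p q).encard ≤ (p.natDegree ^ 2 : ℕ) := by
  by_contra! h
  obtain ⟨t, hts, ht⟩ := Set.exists_subset_encard_eq (Order.add_one_le_of_lt h)
  have hfin : t.Finite := Set.finite_of_encard_eq_coe (k := p.natDegree ^ 2 + 1) (by simpa using ht)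
  have hcard := card_le_of_subset_harmonicZeros (S := hfin.toFinset) (by simpa using hts) hpq
  rw [hfin.encard_eq_coe_toFinset_card] at ht
  have : hfin.toFinset.card = p.natDegree ^ 2 + 1 := by exact_mod_cast ht
  omega

theorem maxHarmonicZeros_le {n m : ℕ} (h : m < n) : maxHarmonicZeros n m ≤ (n ^ 2 : ℕ) := by
  refine sSup_le ?_
  rintro _ ⟨p, q, hp, hq, rfl⟩
  have hp' := Polynomial.natDegree_eq_of_degree_eq_some hp
  have hq' := Polynomial.natDegree_eq_of_degree_eq_some hq
  rw [← hp']
  exact encard_harmonicZeros_le (by omega)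

theorem harmonicZeroCounts_nonempty (n m : ℕ) : (harmonicZeroCounts n m).Nonempty :=
  ⟨_, Polynomial.X ^ n, Polynomial.X ^ m, Polynomial.degree_X_pow n, Polynomial.degree_X_pow m, rfl⟩

/-! ### Persistence of nondegenerate zeros -/

/-- Near a zero of `f` at which the real derivative is injective, every small perturbation
`f + ε g` has a zero. The reason is that `(ε, z) ↦ (ε, f z + ε g z)` is locally open at `(0, z₀)`. -/
theorem eventually_exists_zero_add_smul {f g : ℂ → ℂ} {f' g' : ℂ →L[ℝ] ℂ} {z₀ : ℂ}
    (hf : HasStrictFDerivAt f f' z₀) (hg : HasStrictFDerivAt g g' z₀)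
    (hinj : ∀ v, f' v = 0 → v = 0) (h₀ : f z₀ = 0) {U : Set ℂ} (hU : U ∈ nhds z₀) :
    ∀ᶠ ε : ℝ in nhds 0, ∃ z ∈ U, f z + ε • g z = 0 := by
  have hsnd : HasStrictFDerivAt (fun x : ℝ × ℂ => x.2) (ContinuousLinearMap.snd ℝ ℝ ℂ) (0, z₀) :=
    hasStrictFDerivAt_snd
  have hfst : HasStrictFDerivAt (fun x : ℝ × ℂ => x.1) (ContinuousLinearMap.fst ℝ ℝ ℂ) (0, z₀) :=
    hasStrictFDerivAt_fst
  have hf2 : HasStrictFDerivAt (fun x : ℝ × ℂ => f x.2) _ (0, z₀) :=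
    HasStrictFDerivAt.comp (0, z₀) (g := f) hf hsnd
  have hg2 : HasStrictFDerivAt (fun x : ℝ × ℂ => g x.2) _ (0, z₀) :=
    HasStrictFDerivAt.comp (0, z₀) (g := g) hg hsnd
  have hG := hfst.prodMk (hf2.add (hfst.smul hg2))
  obtain ⟨G', hG', hfstG, hG⟩ : ∃ G' : ℝ × ℂ →L[ℝ] ℝ × ℂ, (∀ v, G' (0, v) = (0, f' v)) ∧
      (∀ v, (G' v).1 = v.1) ∧
      HasStrictFDerivAt (fun x : ℝ × ℂ => (x.1, f x.2 + x.1 • g x.2)) G' (0, z₀) :=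
    ⟨_, fun v => by simp, fun v => by simp, hG⟩
  have hker : ∀ v, G' v = 0 → v = 0 := by
    rintro ⟨t, v⟩ hv
    obtain rfl : t = 0 := by simpa [hv] using (hfstG (t, v)).symm
    rw [hG', Prod.mk_eq_zero] at hv
    simp [hinj v hv.2]
  have hsurj : Function.Surjective G' := by
    have : Function.Injective G'.toLinearMap :=
      (injective_iff_map_eq_zero _).2 hker
    exact LinearMap.surjective_of_injective this
  have hmap := hG.map_nhds_eq_of_surj (LinearMap.range_eq_top.2 hsurj)
  have hmem : (Set.univ ×ˢ U : Set (ℝ × ℂ)) ∈ nhds ((0 : ℝ), z₀) :=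
    prod_mem_nhds Filter.univ_mem hU
  have himg := Filter.image_mem_map (m := fun x : ℝ × ℂ => (x.1, f x.2 + x.1 • g x.2)) hmem
  rw [hmap] at himg
  have hcont : Filter.Tendsto (fun ε : ℝ => (ε, (0 : ℂ))) (nhds 0)
      (nhds ((0 : ℝ), f z₀ + (0 : ℝ) • g z₀)) := by
    rw [h₀, zero_smul, add_zero]
    exact (Continuous.prodMk_left (0 : ℂ)).tendsto 0
  filter_upwards [hcont himg] with ε hε
  obtain ⟨⟨t, z⟩, ⟨-, hz⟩, heq⟩ := hε
  simp only [Prod.mk.injEq] at heq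
  obtain ⟨rfl, h⟩ := heq
  exact ⟨z, hz, h⟩

/-- The hypothesis `‖p'‖ ≠ ‖q'‖` says that the real Jacobian `|p'| ^ 2 - |q'| ^ 2` of `p + conj q`
does not vanish. -/
theorem eventually_card_le_encard_harmonicZeros {p q r : ℂ[X]} {T : Finset ℂ}
    (hT : ∀ z ∈ T, p.eval z + conj (q.eval z) = 0)
    (hJ : ∀ z ∈ T, ‖p.derivative.eval z‖ ≠ ‖q.derivative.eval z‖) :
    ∀ᶠ ε : ℝ in nhds 0,
      (T.card : ℕ∞) ≤ (harmonicZeros (p + Polynomial.C (ε : ℂ) * r) q).encard := by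
  obtain ⟨U, hU, hdisj⟩ := T.finite_toSet.t2_separation
  have hev : ∀ z ∈ T, ∀ᶠ ε : ℝ in nhds 0,
      ∃ w ∈ U z, (p.eval w + conj (q.eval w)) + ε • r.eval w = 0 := by
    intro z hz
    have hp := ((p.hasStrictDerivAt z).hasStrictFDerivAt).restrictScalars ℝ
    have hq := ((q.hasStrictDerivAt z).hasStrictFDerivAt).restrictScalars ℝ
    have hr := ((r.hasStrictDerivAt z).hasStrictFDerivAt).restrictScalars ℝ
    have hqc : HasStrictFDerivAt (fun w => conj (q.eval w)) _ z :=
      HasStrictFDerivAt.comp z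
        (Complex.conjCLE : ℂ →L[ℝ] ℂ).hasStrictFDerivAt hq
    refine eventually_exists_zero_add_smul (hp.add hqc) hr ?_ (hT z hz)
      ((hU z).2.mem_nhds (hU z).1)
    intro v hv
    have h : v * p.derivative.eval z + conj (v * q.derivative.eval z) = 0 := by simpa using hv
    have h2 : ‖v‖ * ‖p.derivative.eval z‖ = ‖v‖ * ‖q.derivative.eval z‖ := by
      have := congrArg norm (eq_neg_of_add_eq_zero_left h)
      rwa [norm_neg, Complex.norm_conj, norm_mul, norm_mul] at this
    by_contra hv0
    exact hJ z hz (mul_left_cancel₀ (norm_ne_zero_iff.2 hv0) h2)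
  filter_upwards [(Filter.eventually_all_finset T).2 hev] with ε hε
  choose! w hwU hw using hε
  have hinj : Set.InjOn w T := by
    intro a ha b hb hab
    by_contra hne
    exact Set.disjoint_left.1 (hdisj ha hb hne) (hwU a ha) (hab ▸ hwU b hb)
  rw [← Set.encard_coe_eq_coe_finsetCard, ← hinj.encard_image]
  refine Set.encard_le_encard ?_
  rintro _ ⟨z, hz, rfl⟩
  have := hw z hz
  simp only [harmonicZeros, Set.mem_ofPred_eq, Polynomial.eval_add, Polynomial.eval_mul,
    Polynomial.eval_C]
  rw [Complex.real_smul] at this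
  linear_combination this

/-! ### The line arrangement -/

/-- If `z` lies on a line of each pencil and off the real axis, then the two lines meet
transversally. -/
theorem norm_add_ne_norm_sub_of_pencils {m : ℕ} {z : ℂ} (h0 : (z ^ (m + 1)).re = 0)
    (h1 : ((z - 1) ^ (m + 1)).im = 0) (hz : z.im ≠ 0) :
    ‖z ^ m + (z - 1) ^ m‖ ≠ ‖z ^ m - (z - 1) ^ m‖ := by
  intro h
  have hz0 : z ≠ 0 := by rintro rfl; simp at hz
  have hz1 : z - 1 ≠ 0 := by
    intro h
    rw [sub_eq_zero.1 h] at hz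
    simp at hz
  -- Equality of the norms means that `z ^ m * conj ((z - 1) ^ m)` is purely imaginary. So is
  -- `z ^ (m + 1) * conj ((z - 1) ^ (m + 1))`, while their ratio `z * conj (z - 1)` is not real.
  have hre : (z ^ m * conj ((z - 1) ^ m)).re = 0 := by
    have h2 : ‖z ^ m + (z - 1) ^ m‖ ^ 2 = ‖z ^ m - (z - 1) ^ m‖ ^ 2 := by rw [h]
    rw [← Complex.normSq_eq_norm_sq, ← Complex.normSq_eq_norm_sq, Complex.normSq_add,
      Complex.normSq_sub] at h2
    linarith
  have hprod : (z ^ m * conj ((z - 1) ^ m)) * (z * conj (z - 1))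
      = z ^ (m + 1) * conj ((z - 1) ^ (m + 1)) := by
    rw [pow_succ, pow_succ, map_mul]
    ring
  have hY : (z * conj (z - 1)).im = -z.im := by
    simp [Complex.mul_im]
    ring
  have hre2 := congrArg Complex.re hprod
  rw [Complex.mul_re, hre, hY, Complex.mul_re (z ^ (m + 1)), h0, Complex.conj_im, h1] at hre2
  have him : (z ^ m * conj ((z - 1) ^ m)).im = 0 := by
    have : (z ^ m * conj ((z - 1) ^ m)).im * z.im = 0 := by linarith
    exact (mul_eq_zero.1 this).resolve_right hz
  have hzero : z ^ m * conj ((z - 1) ^ m) = 0 := Complex.ext hre him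
  rcases mul_eq_zero.1 hzero with h | h
  · exact pow_ne_zero m hz0 h
  · exact pow_ne_zero m hz1 (star_eq_zero.1 h)

/-- The intersection of the line through `0` of angle `α` with the line through `1` of
angle `β`, provided that `sin (β - α) ≠ 0`. -/
noncomputable def lineMeet (α β : ℝ) : ℂ :=
  (Real.sin β / Real.sin (β - α) : ℝ) * Complex.exp (α * Complex.I)

theorem lineMeet_sub_one {α β : ℝ} (h : Real.sin (β - α) ≠ 0) :
    lineMeet α β - 1 = (Real.sin α / Real.sin (β - α) : ℝ) * Complex.exp (β * Complex.I) := by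
  have h' := h
  rw [Real.sin_sub] at h'
  apply Complex.ext
  · simp only [lineMeet, Complex.sub_re, Complex.re_ofReal_mul, Complex.exp_ofReal_mul_I_re,
      Complex.one_re, Real.sin_sub]
    field_simp
    ring
  · simp only [lineMeet, Complex.sub_im, Complex.im_ofReal_mul, Complex.exp_ofReal_mul_I_im,
      Complex.one_im]
    ring

theorem lineMeet_im (α β : ℝ) :
    (lineMeet α β).im = Real.sin β / Real.sin (β - α) * Real.sin α := by
  simp only [lineMeet, Complex.im_ofReal_mul, Complex.exp_ofReal_mul_I_im]

/-- A nonzero point on a line through `0` determines the angle of this line modulo `π`. -/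
theorem sin_sub_eq_zero_of_mul_exp_eq {r s α β : ℝ} (hr : r ≠ 0)
    (h : (r : ℂ) * Complex.exp (α * Complex.I) = s * Complex.exp (β * Complex.I)) :
    Real.sin (α - β) = 0 := by
  have hre := congrArg Complex.re h
  have him := congrArg Complex.im h
  simp only [Complex.re_ofReal_mul, Complex.im_ofReal_mul, Complex.exp_ofReal_mul_I_re,
    Complex.exp_ofReal_mul_I_im] at hre him
  have : r * Real.sin (α - β) = 0 := by
    rw [Real.sin_sub]
    linear_combination Real.cos β * him - Real.sin β * hre
  exact (mul_eq_zero.1 this).resolve_left hr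

theorem exists_finset_pencils (m : ℕ) : ∃ T : Finset ℂ, T.card = (m + 1) * m ∧
    ∀ z ∈ T, (z ^ (m + 1)).re = 0 ∧ ((z - 1) ^ (m + 1)).im = 0 ∧ z.im ≠ 0 := by
  have hN : (0 : ℝ) < m + 1 := by positivity
  have hpi := Real.pi_pos
  let α : Fin (m + 1) → ℝ := fun j => (2 * j + 1) * Real.pi / (2 * (m + 1))
  -- The index is shifted by one to leave out the real axis.
  let β : Fin m → ℝ := fun k => (k + 1) * Real.pi / (m + 1)
  have hα : ∀ j, 0 < α j ∧ α j < Real.pi := by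
    intro j
    have hj : (j : ℝ) ≤ m := by exact_mod_cast Nat.le_of_lt_succ j.2
    refine ⟨by positivity, ?_⟩
    simp only [α]
    rw [div_lt_iff₀ (by positivity)]
    nlinarith
  have hβ : ∀ k, 0 < β k ∧ β k < Real.pi := by
    intro k
    have hk : (k : ℝ) + 1 ≤ m := by exact_mod_cast k.2
    refine ⟨by positivity, ?_⟩
    simp only [β]
    rw [div_lt_iff₀ (by positivity)]
    nlinarith
  have hsα : ∀ j, Real.sin (α j) ≠ 0 := fun j =>
    (Real.sin_pos_of_pos_of_lt_pi (hα j).1 (hα j).2).ne'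
  have hsβ : ∀ k, Real.sin (β k) ≠ 0 := fun k =>
    (Real.sin_pos_of_pos_of_lt_pi (hβ k).1 (hβ k).2).ne'
  -- `β k - α j` is an odd multiple of `π / (2 * (m + 1))`, so no two of the lines are parallel.
  have hs : ∀ j k, Real.sin (β k - α j) ≠ 0 := by
    intro j k h
    have h0 := (Real.sin_eq_zero_iff_of_lt_of_lt (by linarith [(hα j).2, (hβ k).1])
      (by linarith [(hα j).1, (hβ k).2])).1 h
    have h1 : (2 * ((k : ℝ) + 1) - (2 * j + 1)) * Real.pi = 0 := by
      simp only [α, β] at h0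
      field_simp at h0
      linear_combination h0
    have h2 : 2 * ((k : ℝ) + 1) = 2 * j + 1 := by
      have := (mul_eq_zero.1 h1).resolve_right hpi.ne'
      linarith
    have h3 : 2 * ((k : ℕ) + 1) = 2 * (j : ℕ) + 1 := by exact_mod_cast h2
    omega
  have hinj : Function.Injective fun x : Fin (m + 1) × Fin m => lineMeet (α x.1) (β x.2) := by
    rintro ⟨j, k⟩ ⟨j', k'⟩ h
    simp only at h
    have h1 := congrArg (· - 1) h
    simp only [lineMeet_sub_one (hs _ _)] at h1
    have hj := sin_sub_eq_zero_of_mul_exp_eq (div_ne_zero (hsβ k) (hs j k)) h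
    have hk := sin_sub_eq_zero_of_mul_exp_eq (div_ne_zero (hsα j) (hs j k)) h1
    have hj0 := (Real.sin_eq_zero_iff_of_lt_of_lt (by linarith [(hα j).1, (hα j').2])
      (by linarith [(hα j).2, (hα j').1])).1 hj
    have hk0 := (Real.sin_eq_zero_iff_of_lt_of_lt (by linarith [(hβ k).1, (hβ k').2])
      (by linarith [(hβ k).2, (hβ k').1])).1 hk
    have hjj : (j : ℝ) = j' := by
      have : ((j : ℝ) - j') * Real.pi = 0 := by
        simp only [α] at hj0
        field_simp at hj0
        linear_combination hj0 / 2
      linarith [(mul_eq_zero.1 this).resolve_right hpi.ne']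
    have hkk : (k : ℝ) = k' := by
      have : ((k : ℝ) - k') * Real.pi = 0 := by
        simp only [β] at hk0
        field_simp at hk0
        linear_combination hk0
      linarith [(mul_eq_zero.1 this).resolve_right hpi.ne']
    rw [Prod.mk.injEq]
    exact ⟨Fin.ext (by exact_mod_cast hjj), Fin.ext (by exact_mod_cast hkk)⟩
  refine ⟨Finset.univ.map ⟨_, hinj⟩, by simp, ?_⟩
  intro z hz
  simp only [Finset.mem_map, Finset.mem_univ, true_and, Function.Embedding.coeFn_mk] at hz
  obtain ⟨⟨j, k⟩, rfl⟩ := hz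
  refine ⟨?_, ?_, ?_⟩
  · have hang : ((m + 1 : ℕ) : ℂ) * (α j * Complex.I)
        = ((j * Real.pi + Real.pi / 2 : ℝ) : ℂ) * Complex.I := by
      have : ((m + 1 : ℕ) : ℝ) * α j = j * Real.pi + Real.pi / 2 := by
        simp only [α]
        push_cast
        field_simp
      rw [← this]
      push_cast
      ring
    rw [lineMeet, mul_pow, ← Complex.exp_nat_mul, hang, ← Complex.ofReal_pow,
      Complex.re_ofReal_mul, Complex.exp_ofReal_mul_I_re, Real.cos_add_pi_div_two,
      Real.sin_nat_mul_pi]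
    simp
  · have hang : ((m + 1 : ℕ) : ℂ) * (β k * Complex.I)
        = (((k + 1 : ℕ) * Real.pi : ℝ) : ℂ) * Complex.I := by
      have : ((m + 1 : ℕ) : ℝ) * β k = (k + 1 : ℕ) * Real.pi := by
        simp only [β]
        push_cast
        field_simp
      rw [← this]
      push_cast
      ring
    rw [lineMeet_sub_one (hs j k), mul_pow, ← Complex.exp_nat_mul, hang, ← Complex.ofReal_pow,
      Complex.im_ofReal_mul, Complex.exp_ofReal_mul_I_im, Real.sin_nat_mul_pi]
    simp
  · simp only [lineMeet_im]
    exact mul_ne_zero (div_ne_zero (hsβ k) (hs j k)) (hsα j)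

/-! ### The lower bound -/

theorem degree_X_pow_sub_X_sub_one_pow (m : ℕ) :
    ((Polynomial.X : ℂ[X]) ^ (m + 1) - (Polynomial.X - 1) ^ (m + 1)).degree = (m : WithBot ℕ) := by
  have hmonic : ((Polynomial.X : ℂ[X]) - 1).Monic := by
    simpa using Polynomial.monic_X_sub_C (1 : ℂ)
  have hdeg : ((Polynomial.X : ℂ[X]) - 1).natDegree = 1 := by
    simpa using Polynomial.natDegree_X_sub_C (1 : ℂ)
  have hcoeff : (((Polynomial.X : ℂ[X]) - 1) ^ (m + 1)).coeff m = -(m + 1) := by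
    have h := Polynomial.coeff_X_add_C_pow (-1 : ℂ) (m + 1) m
    simpa [sub_eq_add_neg] using h
  refine Polynomial.degree_eq_of_le_of_coeff_ne_zero ?_ ?_
  · refine Order.le_of_lt_succ ?_
    have h : ((Polynomial.X : ℂ[X]) ^ (m + 1) - (Polynomial.X - 1) ^ (m + 1)).degree
        < ((m + 1 : ℕ) : WithBot ℕ) := by
      have := Polynomial.degree_sub_lt_left (p := (Polynomial.X : ℂ[X]) ^ (m + 1))
        (q := (Polynomial.X - 1) ^ (m + 1)) ?_ (by simp) ?_
      · simpa using this
      · rw [Polynomial.degree_X_pow, Polynomial.degree_eq_natDegree (hmonic.pow _).ne_zero,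
          hmonic.natDegree_pow, hdeg, mul_one]
      · rw [(hmonic.pow _).leadingCoeff, (Polynomial.monic_X_pow _).leadingCoeff]
    exact_mod_cast h
  · rw [Polynomial.coeff_sub, hcoeff, Polynomial.coeff_X_pow]
    have : (m : ℂ) + 1 ≠ 0 := by exact_mod_cast Nat.succ_ne_zero m
    simpa using this

theorem mul_succ_le_maxHarmonicZeros {n m : ℕ} (h : m < n) :
    (((m + 1) * m : ℕ) : ℕ∞) ≤ maxHarmonicZeros n m := by
  obtain ⟨T, hcard, hT⟩ := exists_finset_pencils m
  set p : ℂ[X] := Polynomial.C (1 / 2) * (Polynomial.X ^ (m + 1) + (Polynomial.X - 1) ^ (m + 1))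
    with hp
  set q : ℂ[X] := Polynomial.C (1 / 2) * (Polynomial.X ^ (m + 1) - (Polynomial.X - 1) ^ (m + 1))
    with hq
  have hpd : p.derivative = Polynomial.C (((m : ℂ) + 1) / 2) *
      (Polynomial.X ^ m + (Polynomial.X - 1) ^ m) := by
    rw [hp, Polynomial.derivative_C_mul, Polynomial.derivative_add, Polynomial.derivative_X_pow,
      Polynomial.derivative_pow]
    simp [div_eq_mul_inv]
    ring
  have hqd : q.derivative = Polynomial.C (((m : ℂ) + 1) / 2) *
      (Polynomial.X ^ m - (Polynomial.X - 1) ^ m) := by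
    rw [hq, Polynomial.derivative_C_mul, Polynomial.derivative_sub, Polynomial.derivative_X_pow,
      Polynomial.derivative_pow]
    simp [div_eq_mul_inv]
    ring
  have hzero : ∀ z ∈ T, p.eval z + conj (q.eval z) = 0 := by
    intro z hz
    obtain ⟨h0, h1, -⟩ := hT z hz
    simp only [hp, hq, Polynomial.eval_mul, Polynomial.eval_C, Polynomial.eval_add,
      Polynomial.eval_sub, Polynomial.eval_pow, Polynomial.eval_X, Polynomial.eval_one]
    generalize z ^ (m + 1) = u at h0
    generalize (z - 1) ^ (m + 1) = w at h1
    apply Complex.ext <;> simp [h0, h1]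
  have hJ : ∀ z ∈ T, ‖p.derivative.eval z‖ ≠ ‖q.derivative.eval z‖ := by
    intro z hz heq
    obtain ⟨h0, h1, h2⟩ := hT z hz
    refine norm_add_ne_norm_sub_of_pencils h0 h1 h2 ?_
    have hm : ‖((m : ℂ) + 1) / 2‖ ≠ 0 := by
      have : (m : ℂ) + 1 ≠ 0 := by exact_mod_cast Nat.succ_ne_zero m
      simpa using this
    simp only [hpd, hqd, Polynomial.eval_mul, Polynomial.eval_C, Polynomial.eval_add,
      Polynomial.eval_sub, Polynomial.eval_pow, Polynomial.eval_X, Polynomial.eval_one,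
      norm_mul] at heq
    exact mul_left_cancel₀ hm heq
  obtain ⟨ε, hε, hpos⟩ := (((eventually_card_le_encard_harmonicZeros (r := Polynomial.X ^ n)
    hzero hJ).filter_mono nhdsWithin_le_nhds).and (self_mem_nhdsWithin (s := Set.Ioi 0))).exists
  rw [hcard] at hε
  refine hε.trans (le_sSup ⟨_, q, ?_, ?_, rfl⟩)
  · have hmonic : ((Polynomial.X : ℂ[X]) - 1).Monic := by
      simpa using Polynomial.monic_X_sub_C (1 : ℂ)
    have hdeg : ((Polynomial.X : ℂ[X]) - 1).natDegree = 1 := by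
      simpa using Polynomial.natDegree_X_sub_C (1 : ℂ)
    have hdegp : (((Polynomial.X : ℂ[X]) - 1) ^ (m + 1)).natDegree = m + 1 := by
      rw [hmonic.natDegree_pow, hdeg, mul_one]
    have hpn : p.natDegree ≤ n := by
      refine (Polynomial.natDegree_C_mul_le _ _).trans ((Polynomial.natDegree_add_le _ _).trans ?_)
      rw [Polynomial.natDegree_X_pow, hdegp, max_self]
      omega
    refine Polynomial.degree_eq_of_le_of_coeff_ne_zero ?_ ?_
    · exact (Polynomial.degree_add_le _ _).trans
        (max_le (Polynomial.degree_le_of_natDegree_le hpn) (Polynomial.degree_C_mul_X_pow_le _ _))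
    · rw [Polynomial.coeff_add, Polynomial.coeff_C_mul_X_pow, if_pos rfl]
      have hε0 : (ε : ℂ) ≠ 0 := by exact_mod_cast (ne_of_gt hpos)
      rcases (Nat.succ_le_of_lt h).eq_or_lt with hn | hn
      · -- When `n = m + 1` the leading coefficient is `1 + ε`.
        have h1 : (((Polynomial.X : ℂ[X]) - 1) ^ (m + 1)).coeff (m + 1) = 1 := by
          have := (hmonic.pow (m + 1)).coeff_natDegree
          rwa [hdegp] at this
        subst hn
        rw [hp, Polynomial.coeff_C_mul, Polynomial.coeff_add, h1, Polynomial.coeff_X_pow]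
        have hpos' : (0 : ℝ) < ε := hpos
        have : (1 : ℝ) + ε ≠ 0 := by positivity
        have : (1 : ℂ) + ε ≠ 0 := by exact_mod_cast this
        convert this using 2
        norm_num
      · rw [Polynomial.coeff_eq_zero_of_natDegree_lt, zero_add]
        · exact hε0
        · refine lt_of_le_of_lt ((Polynomial.natDegree_C_mul_le _ _).trans
            (Polynomial.natDegree_add_le _ _)) ?_
          rw [Polynomial.natDegree_X_pow, hdegp, max_self]
          exact hn
  · rw [hq, Polynomial.degree_C_mul (by norm_num), degree_X_pow_sub_X_sub_one_pow]

/-! ### The asymptotic ratio -/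

theorem maxHarmonicZerosRatio_le_one {n m : ℕ} (h : m < n) : maxHarmonicZerosRatio n m ≤ 1 := by
  refine ENNReal.div_le_of_le_mul ?_
  rw [one_mul]
  have := ENat.toENNReal_le.2 (maxHarmonicZeros_le h)
  simpa using this

theorem ofReal_div_sq_le_maxHarmonicZerosRatio {n m : ℕ} (h : m < n) :
    ENNReal.ofReal (((m : ℝ) / n) ^ 2) ≤ maxHarmonicZerosRatio n m := by
  have hn : (0 : ℝ) < n := by exact_mod_cast (Nat.zero_le m).trans_lt h
  rw [div_pow, ENNReal.ofReal_div_of_pos (by positivity), ENNReal.ofReal_pow (by positivity),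
    ENNReal.ofReal_pow (by positivity), ENNReal.ofReal_natCast, ENNReal.ofReal_natCast]
  refine ENNReal.div_le_div_right ?_ _
  have h1 : ((m ^ 2 : ℕ) : ℕ∞) ≤ maxHarmonicZeros n m :=
    le_trans (by exact_mod_cast (by nlinarith : m ^ 2 ≤ (m + 1) * m))
      (mul_succ_le_maxHarmonicZeros h)
  have := ENat.toENNReal_le.2 h1
  simpa using this

theorem ofReal_sq_le_limsup_maxHarmonicZerosRatio {α : ℝ} {m : ℕ → ℕ}
    (hm : ∀ᶠ n : ℕ in atTop, m n < n)
    (ho : (fun n : ℕ => (m n : ℝ) - α * (n : ℝ)) =o[atTop] (fun n : ℕ => (n : ℝ))) :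
    ENNReal.ofReal (α ^ 2) ≤ limsup (fun n : ℕ => maxHarmonicZerosRatio n (m n)) atTop := by
  have hlim : Tendsto (fun n : ℕ => (m n : ℝ) / n) atTop (nhds α) := by
    have h := ho.tendsto_div_nhds_zero.add_const α
    rw [zero_add] at h
    refine h.congr' ?_
    filter_upwards [eventually_gt_atTop 0] with n hn
    have : (n : ℝ) ≠ 0 := by exact_mod_cast hn.ne'
    field_simp
    ring
  have hlim2 := ENNReal.tendsto_ofReal (hlim.pow 2)
  rw [← hlim2.limsup_eq]
  refine limsup_le_limsup ?_
  filter_upwards [hm] with n hn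
  exact ofReal_div_sq_le_maxHarmonicZerosRatio hn

theorem mainTheorem4 :
    (∀ n m : ℕ, m < n →
      maxHarmonicZeros n m ≠ ⊤ ∧ maxHarmonicZeros n m ∈ harmonicZeroCounts n m) ∧
    (∀ a : ℕ, 1 ≤ a →
      limsup (fun n : ℕ => maxHarmonicZerosRatio n (n - a)) atTop = 1) ∧
    (∀ (α : ℝ) (m : ℕ → ℕ), 0 ≤ α → α ≤ 1 →
      (∀ᶠ n : ℕ in atTop, m n < n) →
      (fun n : ℕ => (m n : ℝ) - α * (n : ℝ)) =o[atTop] (fun n : ℕ => (n : ℝ)) →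
      ENNReal.ofReal (α ^ 2) ≤
        limsup (fun n : ℕ => maxHarmonicZerosRatio n (m n)) atTop) := by
  refine ⟨fun n m h => ?_, fun a ha => ?_, fun α m _ _ hm ho =>
    ofReal_sq_le_limsup_maxHarmonicZerosRatio hm ho⟩
  · have hlt : maxHarmonicZeros n m < ⊤ :=
      (maxHarmonicZeros_le h).trans_lt (ENat.natCast_lt_top _)
    have := (harmonicZeroCounts_nonempty n m).to_subtype
    exact ⟨hlt.ne, ENat.sSup_mem_of_nonempty_of_lt_top hlt⟩
  · have hlt : ∀ᶠ n : ℕ in atTop, n - a < n := by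
      filter_upwards [eventually_gt_atTop 0] with n hn
      omega
    refine le_antisymm ?_ ?_
    · refine limsup_le_of_le (by isBoundedDefault) ?_
      filter_upwards [hlt] with n hn
      exact maxHarmonicZerosRatio_le_one hn
    · have ho : (fun n : ℕ => ((n - a : ℕ) : ℝ) - 1 * (n : ℝ)) =o[atTop]
          (fun n : ℕ => (n : ℝ)) := by
        have hconst : (fun _ : ℕ => -(a : ℝ)) =o[atTop] (fun n : ℕ => (n : ℝ)) :=
          isLittleO_const_left.2 (Or.inr (tendsto_norm_atTop_atTop.comp
            tendsto_natCast_atTop_atTop))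
        refine hconst.congr' ?_ EventuallyEq.rfl
        filter_upwards [eventually_ge_atTop a] with n hn
        rw [Nat.cast_sub hn]
        ring
      simpa using ofReal_sq_le_limsup_maxHarmonicZerosRatio hlt ho
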